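/- All digraphs are finite, nonempty and without loops or multiple edges; two edges in opposite directions between a pair of vertices are allowed. An oriented tree is an orientation of an undirected tree. A height function of an oriented tree $T$ is a function $h_T\colon V(T)\to\mathbb{Z}$ with $h_T(v)=h_T(u)+1$ for every edge $(u,v)$ of $T$; it exists and is unique up to an additive constant. Let $U(T)=\{v\in V(T):\deg^-(v)\ge 2\}$. The tree $T$ is called grounded if $h_T$ is constant on $U(T)$. An out-arborescence is an oriented tree in which all edges are oriented away from a designated root vertex. Theorem. Let $T$ be a grounded oriented tree such that the minimal subtree of $T$ containing the vertex set $U(T)$ (a single vertex if $U(T)=\emptyset$) is an out-arborescence. Then $T$ is $\delta^+$-enforcible: there is a $d=d(T)$ such that every digraph $G$ in which every vertex has out-degree at least $d$ contains $T$ as a (not necessarily induced) subgraph. -/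

import Mathlib

universe u v

namespace Digraph

/-- The digraph has no loops. (Multiple edges cannot occur; pairs of opposite edges may.) -/
def IsLoopless {V : Type u} (G : Digraph V) : Prop :=
  ∀ v : V, ¬ G.Adj v v

/-- The out-degree of a vertex: the number of its out-neighbours (for finite digraphs). -/
noncomputable def outDegree {V : Type u} (G : Digraph V) (v : V) : ℕ :=
  {w : V | G.Adj v w}.ncard

/-- The in-degree of a vertex: the number of its in-neighbours (for finite digraphs). -/
noncomputable def inDegree {V : Type u} (G : Digraph V) (v : V) : ℕ :=
  {w : V | G.Adj w v}.ncard

/-- The minimum out-degree `δ⁺(G)` of a nonempty finite digraph. -/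
noncomputable def minOutDegree {V : Type u} (G : Digraph V) : ℕ :=
  ⨅ v : V, G.outDegree v

/-- The subdigraph induced on a set of vertices. -/
def induce {V : Type u} (G : Digraph V) (S : Set V) : Digraph S where
  Adj a b := G.Adj a.1 b.1

/-- `G` contains `H` as a (not necessarily induced) subgraph, up to isomorphism. -/
def ContainsCopy {W : Type v} {V : Type u} (G : Digraph W) (H : Digraph V) : Prop :=
  ∃ f : V → W, Function.Injective f ∧ ∀ a b : V, H.Adj a b → G.Adj (f a) (f b)

/-- An oriented tree: an orientation of an undirected (nonempty) tree, that is, at most one of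
`(a, b)`, `(b, a)` is an edge (so there are no loops either), and the underlying undirected graph
is a tree. -/
structure IsOrientedTree {V : Type u} (T : Digraph V) : Prop where
  asymm : ∀ a b : V, T.Adj a b → ¬ T.Adj b a
  isTree : T.toSimpleGraphInclusive.IsTree

/-- An out-arborescence: an oriented tree with a root vertex `r` such that every edge is directed
away from `r`, that is, its head is further away from `r` in the underlying tree than its tail. -/
def IsOutArborescence {V : Type u} (T : Digraph V) : Prop :=
  T.IsOrientedTree ∧ ∃ r : V, ∀ a b : V, T.Adj a b →
    T.toSimpleGraphInclusive.dist r b = T.toSimpleGraphInclusive.dist r a + 1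

/-- A height function: it increases by exactly one along every edge. (On an oriented tree it
exists and is unique up to an additive constant.) -/
def IsHeightFunction {V : Type u} (T : Digraph V) (h : V → ℤ) : Prop :=
  ∀ a b : V, T.Adj a b → h b = h a + 1

/-- The set `U(T)` of the vertices of in-degree at least two. -/
def branchIn {V : Type u} (T : Digraph V) : Set V :=
  {v : V | 2 ≤ T.inDegree v}

/-- `T` is grounded: its height function is constant on the vertices of in-degree at least two. -/
def IsGrounded {V : Type u} (T : Digraph V) : Prop :=
  ∃ h : V → ℤ, T.IsHeightFunction h ∧ ∀ a ∈ T.branchIn, ∀ b ∈ T.branchIn, h a = h b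

/-- `S` is the vertex set of a minimal subtree of `T` containing all vertices of `U`. In an
oriented tree `T`, subtrees are induced subdigraphs, and for nonempty `U` there is exactly one
minimal subtree containing `U`; for empty `U` the minimal ones are the single vertices. -/
def IsMinimalSubtreeContaining {V : Type u} (T : Digraph V) (U S : Set V) : Prop :=
  Minimal (fun S' : Set V => U ⊆ S' ∧ (T.induce S').IsOrientedTree) S

/-- `T` is `δ⁺`-enforcible: for some `d`, every (nonempty, finite, loopless) digraph of minimum
out-degree at least `d` contains `T` as a subgraph. -/
def IsEnforcible {V : Type u} (T : Digraph V) : Prop :=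
  ∃ d : ℕ, ∀ (W : Type v) [Finite W] [Nonempty W] (G : Digraph W),
    G.IsLoopless → d ≤ G.minOutDegree → G.ContainsCopy T

end Digraph

/-! Write U for the vertices of in-degree at least two. A tree with U empty embeds greedily, in
order of increasing height, since each new vertex has at most one placed neighbour, an in-neighbour.
The obstacle is the several in-edges at vertices of U.

Large minimum out-degree forces a robust vertex, one whose long in-paths survive the deletion of few
other vertices (`exists_isRobust`). Otherwise almost every walk into any vertex would have to
revisit a vertex or hit a small set, so the number of walks of length j into a vertex would be
O((d/2)^j), against d^j per vertex on average. This also applies to induced subdigraphs, so iterated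
levels over the robust set, whose vertices have many out-neighbours one level down, are large
(`exists_bound_outLevel`).

In T, take the ancestors of U. Those with two out-neighbours among the ancestors lie in the
arborescence, hence below its root. Together with U and the ancestors comparable to them they form
the core, where every in-degree is at most one (`core_adj_unique`). Groundedness lets the core embed
greedily along the levels with U on robust vertices. Ancestors outside the core lie on directed
paths entering U, which robustness supplies one at a time. All remaining vertices have in-degree at
most one and are added greedily. -/

/-- There is a path with `n` edges ending at `v` all of whose vertices avoid `X`. -/
def Digraph.HasInPath {W : Type v} (G : Digraph W) : ℕ → Set W → W → Prop
  | 0, X, v => v ∉ X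
  | n + 1, X, v => v ∉ X ∧ ∃ u, G.Adj u v ∧ G.HasInPath n (insert v X) u

/-- Paths with `m` edges into `v` cannot be destroyed by deleting at most `N` other vertices. -/
def Digraph.IsRobust {W : Type v} (G : Digraph W) (m N : ℕ) (v : W) : Prop :=
  ∀ X : Set W, X.ncard ≤ N → v ∉ X → G.HasInPath m X v

namespace Digraph

theorem HasInPath.map {W : Type u} {W' : Type v} {G : Digraph W} {G' : Digraph W'} (φ : W → W')
    (hφ : Function.Injective φ) (hG : ∀ a b, G.Adj a b → G'.Adj (φ a) (φ b)) {n : ℕ} :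
    ∀ {X : Set W'} {v : W}, G.HasInPath n (φ ⁻¹' X) v → G'.HasInPath n X (φ v) := by
  induction n with
  | zero => intro X v h; exact h
  | succ n ih =>
    rintro X v ⟨hv, u, huv, hu⟩
    refine ⟨hv, φ u, hG _ _ huv, ih ?_⟩
    convert hu using 1
    ext x
    simp [hφ.eq_iff]

theorem IsRobust.map {W : Type u} {W' : Type v} [Finite W'] {G : Digraph W} {G' : Digraph W'}
    (φ : W → W') (hφ : Function.Injective φ) (hG : ∀ a b, G.Adj a b → G'.Adj (φ a) (φ b))
    {m N : ℕ} {v : W} (h : G.IsRobust m N v) : G'.IsRobust m N (φ v) := by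
  intro X hX hv
  refine HasInPath.map φ hφ hG (h _ (le_trans ?_ hX) hv)
  rw [← Set.ncard_image_of_injective _ hφ]
  exact Set.ncard_le_ncard (Set.image_preimage_subset _ _)

/-! ### Counting walks and the existence of robust vertices -/

section Counting

open Matrix

variable {W : Type v} [Fintype W] [DecidableEq W]

/-- There are `d ^ i` walks with `i` steps from `b`, and the last step into `a` leaves no choice. -/
theorem pow_entry_le {M : Matrix W W ℕ} {d : ℕ} (h1 : ∀ a b, M a b ≤ 1)
    (hd : ∀ b, ∑ a, M a b = d) (i : ℕ) (a b : W) : (M ^ (i + 1)) a b ≤ d ^ i := by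
  have hsum : ∀ i b, ∑ a, (M ^ i) a b = d ^ i := by
    intro i
    induction i with
    | zero => intro b; simp [Matrix.one_apply]
    | succ i ih =>
      intro b
      simp only [pow_succ, Matrix.mul_apply]
      rw [Finset.sum_comm]
      simp only [← Finset.sum_mul, ih, ← Finset.mul_sum, hd]
  rw [pow_succ', Matrix.mul_apply, ← hsum i b]
  exact Finset.sum_le_sum fun x _ => by nlinarith [h1 a x]

/-- The left side counts `f`-weighted walks of length `n` ending at `y`; `M a b` stands for an edge
from `b` to `a`. Each such walk meets `X` or repeats a vertex. The first sum splits it at a visit to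
`X`. The second excises a closed walk of length `i + 1`, for which there are at most `d ^ i`
choices, at one of `n` positions. -/
theorem walk_count_le {G : Digraph W} {M : Matrix W W ℕ} {d : ℕ}
    (h1 : ∀ a b, M a b ≤ 1) (hG : ∀ a b, M a b ≠ 0 → G.Adj b a)
    (hd : ∀ b, ∑ a, M a b = d) (f : W → ℕ) (n : ℕ) :
    ∀ (X : Finset W) (y : W), y ∉ X → ¬ G.HasInPath n X y →
      (M ^ n *ᵥ f) y ≤
        ∑ x ∈ X, ∑ i ∈ Finset.range n, (M ^ (n - 1 - i) *ᵥ f) x * (M ^ (i + 1)) y x +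
        n * ∑ i ∈ Finset.range n, d ^ i * (M ^ (n - 1 - i) *ᵥ f) y := by
  induction n with
  | zero => intro X y hy h; exact absurd (by simpa [HasInPath] using hy) h
  | succ n ih =>
    intro X y hy h
    have hstep : ∀ u, M y u * (M ^ n *ᵥ f) u ≤
        (if u ∈ insert y X then M y u * (M ^ n *ᵥ f) u else 0) + M y u *
        (∑ x ∈ insert y X, ∑ i ∈ Finset.range n, (M ^ (n - 1 - i) *ᵥ f) x * (M ^ (i + 1)) u x +
          n * ∑ i ∈ Finset.range n, d ^ i * (M ^ (n - 1 - i) *ᵥ f) u) := by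
      intro u
      by_cases hu : u ∈ insert y X
      · simp [hu]
      · rw [if_neg hu, zero_add]
        by_cases hM : M y u = 0
        · simp [hM]
        · refine Nat.mul_le_mul_left _ (ih _ u hu fun hp => h ⟨by simpa using hy, u, hG _ _ hM, ?_⟩)
          simpa using hp
    have hM1 : ∀ k, ∑ u, M y u * (M ^ k *ᵥ f) u = (M ^ (k + 1) *ᵥ f) y := by
      intro k
      rw [pow_succ', ← Matrix.mulVec_mulVec]; rfl
    have hM2 : ∀ i x, ∑ u, M y u * (M ^ i) u x = (M ^ (i + 1)) y x := by
      intro i x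
      rw [pow_succ', Matrix.mul_apply]
    have e1 : ∑ u, (if u ∈ insert y X then M y u * (M ^ n *ᵥ f) u else 0) =
        ∑ x ∈ insert y X, (M ^ n *ᵥ f) x * M y x := by
      rw [← Finset.sum_filter]
      refine Finset.sum_congr (by ext; simp) fun _ _ => mul_comm _ _
    have e2 : ∑ u, M y u * (∑ x ∈ insert y X, ∑ i ∈ Finset.range n,
          (M ^ (n - 1 - i) *ᵥ f) x * (M ^ (i + 1)) u x) =
        ∑ x ∈ insert y X, ∑ i ∈ Finset.range n,
          (M ^ (n - 1 - i) *ᵥ f) x * (M ^ (i + 1 + 1)) y x := by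
      simp only [Finset.mul_sum]
      rw [Finset.sum_comm]
      refine Finset.sum_congr rfl fun x _ => ?_
      rw [Finset.sum_comm]
      refine Finset.sum_congr rfl fun i _ => ?_
      rw [← hM2 (i + 1) x, Finset.mul_sum]
      exact Finset.sum_congr rfl fun _ _ => by ring
    have e3 : ∑ u, M y u * (n * ∑ i ∈ Finset.range n, d ^ i * (M ^ (n - 1 - i) *ᵥ f) u) =
        n * ∑ i ∈ Finset.range n, d ^ i * (M ^ (n - i) *ᵥ f) y := by
      simp only [Finset.mul_sum]
      rw [Finset.sum_comm]
      refine Finset.sum_congr rfl fun i hi => ?_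
      have hi' : n - i = n - 1 - i + 1 := by have := Finset.mem_range.1 hi; omega
      rw [hi', ← hM1, Finset.mul_sum, Finset.mul_sum]
      exact Finset.sum_congr rfl fun _ _ => by ring
    have e4 : ∑ x ∈ insert y X, (M ^ n *ᵥ f) x * M y x +
        ∑ x ∈ insert y X, ∑ i ∈ Finset.range n,
          (M ^ (n - 1 - i) *ᵥ f) x * (M ^ (i + 1 + 1)) y x =
        ∑ x ∈ insert y X, ∑ i ∈ Finset.range (n + 1),
          (M ^ (n - i) *ᵥ f) x * (M ^ (i + 1)) y x := by
      rw [← Finset.sum_add_distrib]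
      refine Finset.sum_congr rfl fun x _ => ?_
      rw [Finset.sum_range_succ', add_comm]
      simp only [Nat.sub_zero, zero_add, pow_one]
      congr 1
      refine Finset.sum_congr rfl fun i _ => ?_
      rw [show n - 1 - i = n - (i + 1) by omega]
    -- Closed walks at the newly forbidden vertex `y` raise the coefficient from `n` to `n + 1`.
    have e5 : ∑ i ∈ Finset.range (n + 1), (M ^ (n - i) *ᵥ f) y * (M ^ (i + 1)) y y ≤
        ∑ i ∈ Finset.range (n + 1), d ^ i * (M ^ (n - i) *ᵥ f) y :=
      Finset.sum_le_sum fun i _ => by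
        rw [mul_comm]; exact Nat.mul_le_mul_right _ (pow_entry_le h1 hd i y y)
    have e6 : n * ∑ i ∈ Finset.range n, d ^ i * (M ^ (n - i) *ᵥ f) y ≤
        n * ∑ i ∈ Finset.range (n + 1), d ^ i * (M ^ (n - i) *ᵥ f) y :=
      Nat.mul_le_mul_left _ (Finset.sum_le_sum_of_subset (by simp))
    rw [← hM1]
    refine (Finset.sum_le_sum fun u _ => hstep u).trans ?_
    simp only [Nat.add_sub_cancel]
    simp only [mul_add, Finset.sum_add_distrib]
    rw [e1, e2, e3, ← add_assoc, e4, Finset.sum_insert hy, add_mul, one_mul]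
    omega

theorem walk_count_growth {G : Digraph W} {M : Matrix W W ℕ} {d m N : ℕ}
    (h1 : ∀ a b, M a b ≤ 1) (hG : ∀ a b, M a b ≠ 0 → G.Adj b a)
    (hd : ∀ b, ∑ a, M a b = d) (hdN : (N + m) * 2 ^ (m + 1) ≤ d) (hd1 : 1 ≤ d)
    (hrob : ∀ v, ¬ G.IsRobust m N v) :
    ∃ K : ℕ, ∀ j v, 2 ^ j * (M ^ j *ᵥ 1) v ≤ K * d ^ j := by
  -- `K` absorbs all lengths below `m`, the base of the induction.
  refine ⟨∑ j ∈ Finset.range m, ∑ v, 2 ^ j * (M ^ j *ᵥ 1) v, fun j => ?_⟩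
  set K := ∑ j ∈ Finset.range m, ∑ v, 2 ^ j * (M ^ j *ᵥ 1) v with hK
  induction j using Nat.strong_induction_on with
  | _ j ih =>
  intro v
  by_cases hj : j < m
  · calc 2 ^ j * (M ^ j *ᵥ 1) v ≤ ∑ v, 2 ^ j * (M ^ j *ᵥ 1) v :=
          Finset.single_le_sum (f := fun v => 2 ^ j * (M ^ j *ᵥ 1) v) (by simp) (Finset.mem_univ v)
      _ ≤ K := Finset.single_le_sum (f := fun j => ∑ v, 2 ^ j * (M ^ j *ᵥ 1) v) (by simp)
          (Finset.mem_range.2 hj)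
      _ ≤ K * d ^ j := Nat.le_mul_of_pos_right _ (by positivity)
  · push Not at hj
    have hr := hrob v
    simp only [IsRobust, not_forall] at hr
    obtain ⟨X, hX, hvX, hp⟩ := hr
    obtain ⟨X, rfl⟩ : ∃ Y : Finset W, X = Y := ⟨X.toFinite.toFinset, by simp⟩
    rw [Set.ncard_coe_finset] at hX
    -- Only the last `m` steps of a walk of length `j` are examined; the weight counts the initial
    -- part.
    have key := walk_count_le h1 hG hd (M ^ (j - m) *ᵥ 1) m X v (by simpa using hvX) hp
    simp only [Matrix.mulVec_mulVec, ← pow_add] at key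
    rw [Nat.add_sub_cancel' hj] at key
    have hterm : ∀ x, ∀ i ∈ Finset.range m,
        2 ^ j * (d ^ i * (M ^ (m - 1 - i + (j - m)) *ᵥ 1) x) ≤ 2 ^ (i + 1) * (K * d ^ (j - 1)) := by
      intro x i hi
      have hi := Finset.mem_range.1 hi
      have := ih (m - 1 - i + (j - m)) (by omega) x
      have e1 : (2 : ℕ) ^ j = 2 ^ (i + 1) * 2 ^ (m - 1 - i + (j - m)) := by
        rw [← pow_add]; congr 1; omega
      have e2 : d ^ (j - 1) = d ^ i * d ^ (m - 1 - i + (j - m)) := by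
        rw [← pow_add]; congr 1; omega
      rw [e1, e2]
      calc _ = 2 ^ (i + 1) * d ^ i *
            (2 ^ (m - 1 - i + (j - m)) * (M ^ (m - 1 - i + (j - m)) *ᵥ 1) x) := by ring
        _ ≤ 2 ^ (i + 1) * d ^ i * (K * d ^ (m - 1 - i + (j - m))) := Nat.mul_le_mul_left _ this
        _ = _ := by ring
    have hgeom : ∑ i ∈ Finset.range m, 2 ^ (i + 1) ≤ 2 ^ (m + 1) := by
      have := Nat.geomSum_lt (m := 2) (n := m + 1) (s := (Finset.range m).image (· + 1)) le_rfl
        (by simp)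
      rw [Finset.sum_image (by simp)] at this
      exact this.le
    have hS : ∀ x, 2 ^ j * ∑ i ∈ Finset.range m, d ^ i * (M ^ (m - 1 - i + (j - m)) *ᵥ 1) x ≤
        2 ^ (m + 1) * (K * d ^ (j - 1)) := by
      intro x
      rw [Finset.mul_sum]
      refine (Finset.sum_le_sum (hterm x)).trans ?_
      rw [← Finset.sum_mul]
      exact Nat.mul_le_mul_right _ hgeom
    have hX1 : ∑ x ∈ X, ∑ i ∈ Finset.range m,
        (M ^ (m - 1 - i + (j - m)) *ᵥ 1) x * (M ^ (i + 1)) v x ≤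
        ∑ x ∈ X, ∑ i ∈ Finset.range m, d ^ i * (M ^ (m - 1 - i + (j - m)) *ᵥ 1) x :=
      Finset.sum_le_sum fun x _ => Finset.sum_le_sum fun i _ => by
        rw [mul_comm]; exact Nat.mul_le_mul_right _ (pow_entry_le h1 hd i v x)
    have hm : m = 0 ∨ 1 ≤ j := by omega
    rcases hm with rfl | hj1
    · exact absurd (by simpa [HasInPath] using hvX) hp
    calc 2 ^ j * (M ^ j *ᵥ 1) v ≤ 2 ^ j * (∑ x ∈ X, ∑ i ∈ Finset.range m,
            d ^ i * (M ^ (m - 1 - i + (j - m)) *ᵥ 1) x +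
          m * ∑ i ∈ Finset.range m, d ^ i * (M ^ (m - 1 - i + (j - m)) *ᵥ 1) v) :=
          Nat.mul_le_mul_left _ (key.trans (Nat.add_le_add_right hX1 _))
      _ = ∑ x ∈ X, 2 ^ j * ∑ i ∈ Finset.range m, d ^ i * (M ^ (m - 1 - i + (j - m)) *ᵥ 1) x +
          m * (2 ^ j * ∑ i ∈ Finset.range m, d ^ i * (M ^ (m - 1 - i + (j - m)) *ᵥ 1) v) := by
          rw [mul_add, Finset.mul_sum]; ring
      _ ≤ X.card * (2 ^ (m + 1) * (K * d ^ (j - 1))) + m * (2 ^ (m + 1) * (K * d ^ (j - 1))) := by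
          refine Nat.add_le_add ?_ (Nat.mul_le_mul_left _ (hS v))
          rw [← smul_eq_mul X.card]
          exact Finset.sum_le_card_nsmul _ _ _ fun x _ => hS x
      _ ≤ N * (2 ^ (m + 1) * (K * d ^ (j - 1))) + m * (2 ^ (m + 1) * (K * d ^ (j - 1))) := by
          gcongr
      _ = (N + m) * 2 ^ (m + 1) * (K * d ^ (j - 1)) := by ring
      _ ≤ d * (K * d ^ (j - 1)) := Nat.mul_le_mul_right _ hdN
      _ = K * d ^ j := by
          obtain ⟨j, rfl⟩ : ∃ i, j = i + 1 := ⟨j - 1, by omega⟩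
          rw [Nat.add_sub_cancel, pow_succ]; ring

end Counting

/-- A digraph of large minimum out-degree has a vertex with robust long paths into it. -/
theorem exists_isRobust (m N : ℕ) {W : Type v} [Finite W] [Nonempty W] (G : Digraph W)
    (hG : ∀ w, (N + m) * 2 ^ (m + 1) + 1 ≤ {x | G.Adj w x}.ncard) : ∃ v, G.IsRobust m N v := by
  classical
  have := Fintype.ofFinite W
  set d := (N + m) * 2 ^ (m + 1) + 1 with hd
  by_contra! hrob
  -- Pruning to out-degree exactly `d` makes the number of walks of length `j` exactly `d ^ j` per
  -- starting vertex.
  have hN : ∀ w, ∃ S : Finset W, (∀ x ∈ S, G.Adj w x) ∧ S.card = d := by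
    intro w
    obtain ⟨S, hS, hc⟩ := Finset.exists_subset_card_eq
      (s := {x | G.Adj w x}.toFinset) (n := d) (by rw [← Set.ncard_eq_toFinset_card']; exact hG w)
    exact ⟨S, fun x hx => by simpa using hS hx, hc⟩
  choose S hS hSc using hN
  let M : Matrix W W ℕ := fun a b => if a ∈ S b then 1 else 0
  have hM : ∀ b, ∑ a, M a b = d := fun b => by simp [M, hSc]
  obtain ⟨K, hK⟩ := walk_count_growth (G := G) (M := M) (d := d) (m := m) (N := N)
    (fun a b => by simp only [M]; split_ifs <;> simp)
    (fun a b h => hS _ _ (by by_contra h'; simp [M, h'] at h)) hM (by omega) (by omega) hrob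
  have hsum : ∀ j, ∑ v, (M ^ j).mulVec 1 v = Fintype.card W * d ^ j := by
    intro j
    induction j with
    | zero => simp
    | succ j ih =>
      rw [pow_succ', ← Matrix.mulVec_mulVec]
      simp only [Matrix.mulVec, dotProduct] at ih ⊢
      rw [Finset.sum_comm]
      simp only [← Finset.sum_mul, hM, ← Finset.mul_sum, ih]
      ring
  -- Length `j = K` suffices, as `K < 2 ^ K`.
  have h2 : 2 ^ K * (Fintype.card W * d ^ K) ≤ Fintype.card W * (K * d ^ K) := by
    rw [← hsum, Finset.mul_sum]
    exact (Finset.sum_le_sum fun v _ => hK K v).trans (by simp)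
  have hpos : 0 < Fintype.card W * d ^ K := by
    have := Fintype.card_pos (α := W)
    positivity
  have h3 : 2 ^ K * (Fintype.card W * d ^ K) ≤ K * (Fintype.card W * d ^ K) := by linarith
  exact absurd (Nat.le_of_mul_le_mul_right h3 hpos) (not_le.2 K.lt_two_pow_self)

end Digraph

/-! ### Levels over the robust vertices -/

namespace Digraph

/-- Starting from `B`, iterate the operation of taking all vertices that have at least `n`
out-neighbours in the previous set. -/
def outLevel {W : Type v} (G : Digraph W) (n : ℕ) (B : Set W) : ℕ → Set W
  | 0 => B
  | i + 1 => {v | n ≤ {w | G.Adj v w ∧ w ∈ G.outLevel n B i}.ncard}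

/-- If `Z` misses level `k + 1`, deleting level `k` from `Z` costs each vertex fewer than `n`
out-neighbours, and what remains contradicts the case `k`. -/
theorem exists_mem_outLevel {W : Type v} [Finite W] (G : Digraph W) (n d : ℕ) (B : Set W)
    (hB : ∀ Z : Set W, Z.Nonempty → (∀ z ∈ Z, d ≤ {w | G.Adj z w ∧ w ∈ Z}.ncard) →
      ∃ z ∈ Z, z ∈ B) (k : ℕ) :
    ∀ Z : Set W, Z.Nonempty → (∀ z ∈ Z, d + k * n ≤ {w | G.Adj z w ∧ w ∈ Z}.ncard) →
      ∃ z ∈ Z, z ∈ G.outLevel n B k := by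
  induction k with
  | zero => simpa [outLevel] using hB
  | succ k ih =>
    intro Z hZ hd
    by_contra! hno
    have hout : ∀ z ∈ Z, {w | G.Adj z w ∧ w ∈ G.outLevel n B k}.ncard < n := fun z hz => by
      simpa [outLevel] using hno z hz
    have hkey : ∀ z ∈ Z, d + k * n < {w | G.Adj z w ∧ w ∈ Z \ G.outLevel n B k}.ncard := by
      intro z hz
      have h1 := hd z hz
      have h2 := hout z hz
      have h3 : {w | G.Adj z w ∧ w ∈ Z} ⊆ {w | G.Adj z w ∧ w ∈ Z \ G.outLevel n B k} ∪
          {w | G.Adj z w ∧ w ∈ G.outLevel n B k} := by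
        intro w hw
        by_cases h : w ∈ G.outLevel n B k
        · exact Or.inr ⟨hw.1, h⟩
        · exact Or.inl ⟨hw.1, hw.2, h⟩
      have h4 := (Set.ncard_le_ncard h3).trans (Set.ncard_union_le _ _)
      rw [add_mul, one_mul] at h1
      omega
    obtain ⟨z, hz⟩ := hZ
    have hne : (Z \ G.outLevel n B k).Nonempty := by
      obtain ⟨w, hw⟩ := Set.nonempty_of_ncard_ne_zero (Nat.ne_zero_of_lt (hkey z hz))
      exact ⟨w, hw.2⟩
    obtain ⟨w, hw, hw'⟩ := ih _ hne fun z hz => (hkey z hz.1).le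
    exact hw.2 hw'

theorem le_ncard_outLevel {W : Type v} [Finite W] (G : Digraph W) {n : ℕ} (hn : 1 ≤ n)
    (B : Set W) {k : ℕ} (hk : (G.outLevel n B k).Nonempty) {i : ℕ} (hi : i < k) :
    n ≤ (G.outLevel n B i).ncard := by
  have hstep : ∀ i, (G.outLevel n B (i + 1)).Nonempty → n ≤ (G.outLevel n B i).ncard := by
    rintro i ⟨v, hv⟩
    exact le_trans hv (Set.ncard_le_ncard fun w hw => hw.2)
  induction k with
  | zero => omega
  | succ k ih =>
    rcases Nat.lt_succ_iff_lt_or_eq.1 hi with h | rfl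
    · exact ih (Set.nonempty_of_ncard_ne_zero (by have := hstep k hk; omega)) h
    · exact hstep i hk

/-- The levels over the robust vertices are large in digraphs of large minimum out-degree. -/
theorem exists_bound_outLevel (m N n k : ℕ) (hn : 1 ≤ n) : ∃ d : ℕ,
    ∀ (W : Type v) [Finite W] [Nonempty W] (G : Digraph W), (∀ w, d ≤ {x | G.Adj w x}.ncard) →
      ∀ i < k, n ≤ (G.outLevel n {v | G.IsRobust m N v} i).ncard := by
  refine ⟨(N + m) * 2 ^ (m + 1) + 1 + k * n, fun W _ _ G hG i hi => ?_⟩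
  obtain ⟨v, -, hv⟩ := exists_mem_outLevel G n ((N + m) * 2 ^ (m + 1) + 1) {v | G.IsRobust m N v}
    (fun Z hZ hd => by
      have : Nonempty Z := hZ.to_subtype
      obtain ⟨z, hz⟩ := exists_isRobust m N (G.induce Z) fun z => by
        refine (hd z z.2).trans (le_of_eq ?_)
        rw [← Set.ncard_image_of_injective _ Subtype.val_injective]
        congr 1
        ext w
        simp [induce]
      exact ⟨z, z.2, hz.map Subtype.val Subtype.val_injective fun _ _ h => h⟩)
    k Set.univ Set.univ_nonempty (by simpa using hG)
  exact le_ncard_outLevel G hn _ ⟨v, hv⟩ hi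

/-! ### Extending partial embeddings -/

/-- `f` embeds the part of `T` induced on `D` into `G`. -/
structure EmbedsOn {V : Type u} {W : Type v} (T : Digraph V) (G : Digraph W) (D : Set V)
    (f : V → W) : Prop where
  injOn : Set.InjOn f D
  adj : ∀ a ∈ D, ∀ b ∈ D, T.Adj a b → G.Adj (f a) (f b)

section

variable {V : Type u} {W : Type v} {T : Digraph V} {G : Digraph W} {h : V → ℤ}

theorem EmbedsOn.insert_update {D : Set V} {f : V → W} [DecidableEq V] (hf : T.EmbedsOn G D f) {t : V}
    {w : W} (ht : t ∉ D) (htt : ¬ T.Adj t t) (hw : w ∉ f '' D)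
    (hin : ∀ a ∈ D, T.Adj a t → G.Adj (f a) w) (hout : ∀ a ∈ D, T.Adj t a → G.Adj w (f a)) :
    T.EmbedsOn G (insert t D) (Function.update f t w) := by
  have hne : ∀ a ∈ D, a ≠ t := fun a ha h => ht (h ▸ ha)
  constructor
  · intro a ha b hb hab
    rcases ha with rfl | ha <;> rcases hb with rfl | hb
    · rfl
    · rw [Function.update_self, Function.update_of_ne (hne b hb)] at hab
      exact absurd ⟨b, hb, hab.symm⟩ hw
    · rw [Function.update_self, Function.update_of_ne (hne a ha)] at hab
      exact absurd ⟨a, ha, hab⟩ hw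
    · rw [Function.update_of_ne (hne a ha), Function.update_of_ne (hne b hb)] at hab
      exact hf.injOn ha hb hab
  · intro a ha b hb hab
    rcases ha with rfl | ha <;> rcases hb with rfl | hb
    · exact absurd hab htt
    · rw [Function.update_self, Function.update_of_ne (hne b hb)]
      exact hout b hb hab
    · rw [Function.update_self, Function.update_of_ne (hne a ha)]
      exact hin a ha hab
    · rw [Function.update_of_ne (hne a ha), Function.update_of_ne (hne b hb)]
      exact hf.adj a ha b hb hab

theorem IsHeightFunction.not_adj_self (hh : T.IsHeightFunction h) (t : V) : ¬ T.Adj t t :=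
  fun h' => by have := hh t t h'; omega

/-- Greedy embedding of vertices with at most one in-neighbour. -/
theorem EmbedsOn.exists_extension [Finite V] [Finite W] (hh : T.IsHeightFunction h)
    (C : V → Set W) (A : Set V) (hC : ∀ t ∈ A, Nat.card V ≤ (C t).ncard)
    (hCC : ∀ a ∈ A, ∀ t ∈ A, T.Adj a t → ∀ w ∈ C a,
      Nat.card V ≤ {x | G.Adj w x ∧ x ∈ C t}.ncard) (D : Set V) (f : V → W) (hDA : D ⊆ A)
    (hf : T.EmbedsOn G D f) (hfC : ∀ a ∈ D, f a ∈ C a)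
    (hD : ∀ t ∈ D, ∀ a ∈ A, T.Adj a t → a ∈ D)
    (hA : ∀ t ∈ A, t ∉ D → ∀ a ∈ A, ∀ b ∈ A, T.Adj a t → T.Adj b t → a = b) :
    ∃ g : V → W, T.EmbedsOn G A g ∧ ∀ a ∈ A, g a ∈ C a := by
  classical
  induction hk : (A \ D).ncard generalizing D f with
  | zero =>
    rw [Set.ncard_eq_zero, Set.sdiff_eq_empty] at hk
    obtain rfl := hDA.antisymm hk
    exact ⟨f, hf, hfC⟩
  | succ k ih =>
    -- At least height, every in-neighbour of `t` in `A` is already placed.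
    obtain ⟨t, ⟨htA, htD⟩, htmin⟩ := Set.exists_min_image (A \ D) h (Set.toFinite _)
      (Set.nonempty_of_ncard_ne_zero (by omega))
    have hpred : ∀ a ∈ A, T.Adj a t → a ∈ D := by
      intro a ha hat
      by_contra haD
      have := htmin a ⟨ha, haD⟩
      have := hh _ _ hat
      omega
    have hcard : (f '' D).ncard < Nat.card V := by
      refine (Set.ncard_image_le (Set.toFinite _)).trans_lt ?_
      exact Set.ncard_lt_card fun hu => htD (hu ▸ Set.mem_univ t)
    obtain ⟨w, hwC, hwD, hwadj⟩ : ∃ w ∈ C t, w ∉ f '' D ∧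
        ∀ a ∈ D, T.Adj a t → G.Adj (f a) w := by
      by_cases hex : ∃ a ∈ A, T.Adj a t
      · obtain ⟨a, ha, hat⟩ := hex
        obtain ⟨w, hw, hw'⟩ := Set.exists_mem_notMem_of_ncard_lt_ncard
          (hcard.trans_le (hCC a ha t htA hat (f a) (hfC a (hpred a ha hat))))
        refine ⟨w, hw.2, hw', fun b hb hbt => ?_⟩
        rw [hA t htA htD b (hDA hb) a ha hbt hat]
        exact hw.1
      · obtain ⟨w, hw, hw'⟩ := Set.exists_mem_notMem_of_ncard_lt_ncard
          (hcard.trans_le (hC t htA))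
        exact ⟨w, hw, hw', fun b hb hbt => absurd ⟨b, hDA hb, hbt⟩ hex⟩
    refine ih (insert t D) (Function.update f t w) (Set.insert_subset htA hDA)
      (hf.insert_update htD (hh.not_adj_self t) hwD hwadj
        fun a ha hta => absurd (hD a ha t htA hta) htD) ?_ ?_ ?_ ?_
    · rintro a (rfl | ha)
      · simpa using hwC
      · rw [Function.update_of_ne (show a ≠ t from fun e => htD (e ▸ ha))]
        exact hfC a ha
    · rintro b (rfl | hb) a ha hab
      · exact Or.inr (hpred a ha hab)
      · exact Or.inr (hD b hb a ha hab)
    · exact fun b hb hbD => hA b hb fun h => hbD (Or.inr h)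
    · have : A \ insert t D = (A \ D) \ {t} := by
        ext x
        simp only [Set.mem_sdiff, Set.mem_insert_iff, Set.mem_singleton_iff]
        tauto
      rw [this, Set.ncard_sdiff_singleton_of_mem (show t ∈ A \ D from ⟨htA, htD⟩), hk, Nat.add_sub_cancel]

/-- Attach to `s` the unique directed path of `T` that enters `s` from outside `D`. -/
theorem EmbedsOn.exists_extension_inPath [Finite V] {P U : Set V} (hh : T.IsHeightFunction h)
    (hPin : ∀ t ∈ P, ∀ a, T.Adj a t → a ∈ P)
    (hU : ∀ t ∉ U, ∀ a b, T.Adj a t → T.Adj b t → a = b) (q : ℕ) :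
    ∀ (D : Set V) (f : V → W) (s t : V), T.EmbedsOn G D f → D ⊆ P → U ⊆ D →
      (∀ x ∈ D, ∀ y ∈ P, T.Adj x y → y ∈ D) →
      (∀ x ∈ P, x ∉ D → ∀ y ∈ P, ∀ z ∈ P, T.Adj x y → T.Adj x z → y = z) →
      (∀ x ∈ D, x ∉ U → x ≠ s → ∀ a, T.Adj a x → a ∈ D) →
      s ∈ D → t ∉ D → T.Adj t s → Dᶜ.ncard ≤ q → G.HasInPath q (f '' (D \ {s})) (f s) →
      ∃ (D' : Set V) (f' : V → W), T.EmbedsOn G D' f' ∧ D ⊂ D' ∧ D' ⊆ P ∧ Set.EqOn f' f D ∧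
        (∀ x ∈ D', ∀ y ∈ P, T.Adj x y → y ∈ D') ∧
        (∀ x ∈ D', x ∉ U → ∀ a, T.Adj a x → a ∈ D') := by
  classical
  induction q with
  | zero =>
    intro D f s t _ _ _ _ _ _ _ ht _ hq
    have h0 : Dᶜ = ∅ := by rwa [Nat.le_zero, Set.ncard_eq_zero] at hq
    exact absurd (h0 ▸ ht : t ∈ (∅ : Set V)) (by simp)
  | succ q ih =>
    rintro D f s t hf hDP hUD hDout huniq hDin hs ht hts hq ⟨-, w, hw, hpath⟩
    have himg : insert (f s) (f '' (D \ {s})) = f '' D := by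
      rw [← Set.image_insert_eq, Set.insert_sdiff_singleton, Set.insert_eq_of_mem hs]
    rw [himg] at hpath
    have htP : t ∈ P := hPin s (hDP hs) t hts
    have hwD : w ∉ f '' D := by
      cases q with
      | zero => exact hpath
      | succ q => exact hpath.1
    have hne : ∀ a ∈ D, a ≠ t := fun a ha h => ht (h ▸ ha)
    have hts' : ∀ y ∈ P, T.Adj t y → y = s := fun y hy hty =>
      huniq t htP ht y hy s (hDP hs) hty hts
    have hf' : T.EmbedsOn G (insert t D) (Function.update f t w) :=
      hf.insert_update ht (hh.not_adj_self t) hwD (fun a ha hat => absurd (hDout a ha t htP hat) ht)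
        fun a ha hta => by rw [hts' a (hDP ha) hta]; exact hw
    have hsub : insert t D ⊆ P := Set.insert_subset htP hDP
    have hout' : ∀ x ∈ insert t D, ∀ y ∈ P, T.Adj x y → y ∈ insert t D := by
      rintro x (rfl | hx) y hy hxy
      · exact Or.inr (hts' y hy hxy ▸ hs)
      · exact Or.inr (hDout x hx y hy hxy)
    -- The exemption from in-closedness moves from `s` to `t`: outside `U`, the only in-neighbour of
    -- `s` is `t`.
    have hin' : ∀ x ∈ insert t D, x ∉ U → x ≠ t → ∀ a, T.Adj a x → a ∈ insert t D := by
      rintro x (rfl | hx) hxU hxt a hax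
      · exact absurd rfl hxt
      · by_cases hxs : x = s
        · subst hxs
          exact Or.inl (hU x hxU a t hax hts)
        · exact Or.inr (hDin x hx hxU hxs a hax)
    have hEq : Set.EqOn (Function.update f t w) f D := fun a ha =>
      Function.update_of_ne (hne a ha) _ _
    have hss : D ⊂ insert t D := Set.ssubset_insert ht
    by_cases hex : ∃ p, T.Adj p t
    · obtain ⟨p, hp⟩ := hex
      have hpD : p ∉ insert t D := by
        rintro (rfl | hpD)
        · exact hh.not_adj_self p hp
        · exact ht (hDout p hpD t htP hp)
      have hcard : (insert t D)ᶜ.ncard ≤ q := by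
        have := Set.ncard_lt_ncard (compl_lt_compl_iff_lt.2 hss)
        omega
      have himg' : Function.update f t w '' (insert t D \ {t}) = f '' D := by
        rw [Set.insert_sdiff_of_mem _ (Set.mem_singleton t), Set.sdiff_singleton_eq_self ht]
        exact hEq.image_eq
      obtain ⟨D', f', h1, h2, h3, h4, h5, h6⟩ := ih (insert t D) (Function.update f t w) t p hf'
        hsub (hUD.trans hss.subset) hout' (fun x hx hxD => huniq x hx fun h => hxD (Or.inr h))
        hin' (Or.inl rfl) hpD hp hcard (by rw [himg', Function.update_self]; exact hpath)
      exact ⟨D', f', h1, hss.trans h2, h3, fun a ha => (h4 (hss.subset ha)).trans (hEq ha), h5, h6⟩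
    · refine ⟨insert t D, Function.update f t w, hf', hss, hsub, hEq, hout', ?_⟩
      intro x hx hxU a hax
      by_cases hxt : x = t
      · subst hxt
        exact absurd ⟨a, hax⟩ hex
      · exact hin' x hx hxU hxt a hax

/-- Attach all directed paths entering the vertices of `U`, which are embedded robustly. -/
theorem EmbedsOn.exists_extension_inPaths [Finite V] [Finite W] {P U : Set V}
    (hh : T.IsHeightFunction h) (hPin : ∀ t ∈ P, ∀ a, T.Adj a t → a ∈ P)
    (hU : ∀ t ∉ U, ∀ a b, T.Adj a t → T.Adj b t → a = b)
    (D : Set V) (f : V → W) (hf : T.EmbedsOn G D f) (hDP : D ⊆ P) (hUD : U ⊆ D)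
    (hDout : ∀ x ∈ D, ∀ y ∈ P, T.Adj x y → y ∈ D)
    (huniq : ∀ x ∈ P, x ∉ D → ∀ y ∈ P, ∀ z ∈ P, T.Adj x y → T.Adj x z → y = z)
    (hDin : ∀ x ∈ D, x ∉ U → ∀ a, T.Adj a x → a ∈ D)
    (hrob : ∀ u ∈ U, G.IsRobust (Nat.card V) (Nat.card V) (f u)) :
    ∃ (D' : Set V) (f' : V → W), T.EmbedsOn G D' f' ∧ U ⊆ D' ∧
      ∀ x ∈ D', ∀ a, T.Adj a x → a ∈ D' := by
  induction hk : Dᶜ.ncard using Nat.strong_induction_on generalizing D f with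
  | _ k ih =>
  by_cases hcl : ∀ x ∈ D, ∀ a, T.Adj a x → a ∈ D
  · exact ⟨D, f, hf, hUD, hcl⟩
  push Not at hcl
  obtain ⟨s, hs, t, hts, ht⟩ := hcl
  have hsU : s ∈ U := by
    by_contra hsU
    exact ht (hDin s hs hsU t hts)
  have hle : ∀ E : Set V, E.ncard ≤ Nat.card V := fun E => Set.ncard_le_card E
  -- The deleted set is the image of everything placed except `s`.
  obtain ⟨D', f', h1, h2, h3, h4, h5, h6⟩ := EmbedsOn.exists_extension_inPath hh hPin hU
    (Nat.card V) D f s t hf hDP hUD hDout huniq (fun x hx hxU _ => hDin x hx hxU) hs ht hts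
    (hle _) (hrob s hsU _ ((Set.ncard_image_le (Set.toFinite _)).trans (hle _)) (by
      rintro ⟨a, ⟨haD, has⟩, hfa⟩
      exact has (hf.injOn haD hs hfa)))
  refine ih _ ?_ D' f' h1 h3 (hUD.trans h2.subset) h5
    (fun x hx hxD => huniq x hx fun h => hxD (h2.subset h)) h6
    (fun u hu => by rw [h4 (hUD hu)]; exact hrob u hu) rfl
  rw [← hk]
  exact Set.ncard_lt_ncard (compl_lt_compl_iff_lt.2 h2)

end

end Digraph

/-! ### Separation in trees and directed reachability -/

namespace Digraph

open Relation

section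

variable {V : Type u} {T : Digraph V} {h : V → ℤ}

/-- The underlying undirected graph with all edges at `t` removed. -/
def avoid (T : Digraph V) (t : V) : SimpleGraph V where
  Adj a b := T.toSimpleGraphInclusive.Adj a b ∧ a ≠ t ∧ b ≠ t
  symm := ⟨fun _ _ h => ⟨h.1.symm, h.2.2, h.2.1⟩⟩
  loopless := ⟨fun _ h => h.1.ne rfl⟩

/-- Otherwise the edge from `t` to `a` would not be a bridge. -/
theorem eq_of_reachable_avoid (hT : T.toSimpleGraphInclusive.IsAcyclic) {t a b : V}
    (ha : T.toSimpleGraphInclusive.Adj t a) (hb : T.toSimpleGraphInclusive.Adj t b)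
    (hab : (T.avoid t).Reachable a b) : a = b := by
  by_contra hne
  have hbr := SimpleGraph.isAcyclic_iff_forall_adj_isBridge.1 hT ha
  rw [SimpleGraph.isBridge_iff] at hbr
  refine hbr ?_
  have hle : T.avoid t ≤ T.toSimpleGraphInclusive.deleteEdges {s(t, a)} := by
    intro x y hxy
    rw [SimpleGraph.deleteEdges_adj, Set.mem_singleton_iff, Sym2.eq_iff]
    refine ⟨hxy.1, ?_⟩
    rintro (h | h)
    · exact hxy.2.1 h.1
    · exact hxy.2.2 h.2
  refine SimpleGraph.Reachable.trans (SimpleGraph.Adj.reachable ?_) (hab.mono hle).symm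
  rw [SimpleGraph.deleteEdges_adj, Set.mem_singleton_iff, Sym2.eq_iff]
  refine ⟨hb, ?_⟩
  rintro (h | h)
  · exact hne h.2.symm
  · exact hb.ne h.2.symm

theorem IsHeightFunction.le_of_reflTransGen (hh : T.IsHeightFunction h) {a b : V}
    (hab : ReflTransGen T.Adj a b) : h a ≤ h b := by
  induction hab with
  | refl => rfl
  | tail _ hbc ih => have := hh _ _ hbc; omega

theorem IsHeightFunction.inclusive_adj (hh : T.IsHeightFunction h) {a b : V} (hab : T.Adj a b) :
    T.toSimpleGraphInclusive.Adj a b :=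
  ⟨fun e => hh.not_adj_self b (e ▸ hab), Or.inl hab⟩

theorem IsHeightFunction.reachable_avoid (hh : T.IsHeightFunction h) {a b t : V}
    (hab : ReflTransGen T.Adj a b) (ht : h b < h t ∨ h t < h a) : (T.avoid t).Reachable a b := by
  induction hab with
  | refl => rfl
  | @tail c b hac hcb ih =>
    have h1 := hh _ _ hcb
    have h2 := hh.le_of_reflTransGen hac
    refine (ih (by omega)).trans (SimpleGraph.Adj.reachable ⟨hh.inclusive_adj hcb, ?_, ?_⟩)
    · rintro rfl; omega
    · rintro rfl; omega

theorem reachable_avoid_of_induce {S : Set V}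
    (hS : (T.induce S).toSimpleGraphInclusive.Connected) {t : V} (ht : t ∉ S) {a b : V}
    (ha : a ∈ S) (hb : b ∈ S) : (T.avoid t).Reachable a b := by
  let φ : (T.induce S).toSimpleGraphInclusive →g T.avoid t :=
    { toFun := Subtype.val
      map_rel' := fun {x y} hxy => ⟨⟨fun e => hxy.1 (Subtype.ext e), hxy.2⟩,
        fun e => ht (e ▸ x.2), fun e => ht (e ▸ y.2)⟩ }
  exact (hS ⟨a, ha⟩ ⟨b, hb⟩).map φ

/-- Every vertex of an out-arborescence is reachable from the root by a directed path. -/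
theorem IsOutArborescence.exists_root (hT : T.IsOutArborescence) :
    ∃ r, ∀ v, ReflTransGen T.Adj r v := by
  obtain ⟨hT, r, hr⟩ := hT
  refine ⟨r, fun v => ?_⟩
  have hc := hT.isTree.connected
  induction hk : T.toSimpleGraphInclusive.dist r v generalizing v with
  | zero => rw [hc.dist_eq_zero_iff] at hk; rw [hk]
  | succ k ih =>
    obtain ⟨p, hp⟩ := hc.exists_walk_length_eq_dist v r
    rw [SimpleGraph.dist_comm, hk] at hp
    cases p with
    | nil => simp at hp
    | @cons _ y _ hvy q =>
      simp only [SimpleGraph.Walk.length_cons, Nat.add_right_cancel_iff] at hp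
      have hy : T.toSimpleGraphInclusive.dist r y ≤ k := by
        rw [SimpleGraph.dist_comm, ← hp]; exact SimpleGraph.dist_le q
      rcases hvy.2 with hvy | hyv
      · have := hr _ _ hvy; omega
      · have := hr _ _ hyv
        exact (ih y (by omega)).tail hyv

theorem reflTransGen_of_induce {S : Set V} {a b : S}
    (hab : ReflTransGen (T.induce S).Adj a b) : ReflTransGen T.Adj a.1 b.1 :=
  hab.lift Subtype.val fun _ _ h => h

end

/-! ### The core of the ancestors of `U` -/

section Core

variable {V : Type u}

/-- The vertices from which `U` can be reached by a directed path. -/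
def ancestors (T : Digraph V) (U : Set V) : Set V :=
  {x | ∃ u ∈ U, ReflTransGen T.Adj x u}

/-- The ancestors of `U` having two out-neighbours that are ancestors of `U`. -/
def branchOut (T : Digraph V) (U : Set V) : Set V :=
  {s | ∃ y ∈ T.ancestors U, ∃ z ∈ T.ancestors U, y ≠ z ∧ T.Adj s y ∧ T.Adj s z}

/-- `U` together with all its ancestors on a common directed path with a branching ancestor. -/
def core (T : Digraph V) (U : Set V) : Set V :=
  U ∪ {t ∈ T.ancestors U | ∃ s ∈ T.branchOut U, ReflTransGen T.Adj s t ∨ ReflTransGen T.Adj t s}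

variable {T : Digraph V} {U S : Set V} {h : V → ℤ} {H : ℤ}

theorem subset_ancestors : U ⊆ T.ancestors U := fun u hu => ⟨u, hu, .refl⟩

theorem mem_ancestors_of_adj {a t : V} (hat : T.Adj a t) (ht : t ∈ T.ancestors U) :
    a ∈ T.ancestors U := by
  obtain ⟨u, hu, htu⟩ := ht
  exact ⟨u, hu, htu.head hat⟩

theorem core_subset : T.core U ⊆ T.ancestors U :=
  Set.union_subset subset_ancestors fun _ hx => hx.1

theorem height_le_of_mem_ancestors (hh : T.IsHeightFunction h) (hH : ∀ u ∈ U, h u = H) {x : V}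
    (hx : x ∈ T.ancestors U) : h x ≤ H := by
  obtain ⟨u, hu, hxu⟩ := hx
  exact hH u hu ▸ hh.le_of_reflTransGen hxu

theorem not_adj_ancestor (hh : T.IsHeightFunction h) (hH : ∀ u ∈ U, h u = H) {u x : V}
    (hu : u ∈ U) (hx : x ∈ T.ancestors U) : ¬ T.Adj u x := by
  intro hux
  have h1 := height_le_of_mem_ancestors hh hH hx
  have h2 := hh _ _ hux
  rw [hH u hu] at h2
  omega

/-- The branching ancestors belong to every subtree containing `U`. -/
theorem branchOut_subset (hh : T.IsHeightFunction h)
    (hT : T.toSimpleGraphInclusive.IsAcyclic)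
    (hS : (T.induce S).toSimpleGraphInclusive.Connected) (hUS : U ⊆ S) : T.branchOut U ⊆ S := by
  rintro s ⟨y, ⟨u, hu, hyu⟩, z, ⟨w, hw, hzw⟩, hyz, hsy, hsz⟩
  by_contra hs
  have h1 := hh _ _ hsy
  have h2 := hh _ _ hsz
  -- Outside `S`, the vertex `s` would be bypassed by a connection from `y` to `z` through `S`.
  exact hyz (eq_of_reachable_avoid hT (hh.inclusive_adj hsy) (hh.inclusive_adj hsz)
    ((hh.reachable_avoid hyu (Or.inr (by omega))).trans
      ((reachable_avoid_of_induce hS hs (hUS hu) (hUS hw)).trans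
        (hh.reachable_avoid hzw (Or.inr (by omega))).symm)))

/-- Every in-neighbour of `t` in the core is joined to `r` through a branching ancestor without
passing `t`, and a tree allows only one such neighbour. -/
theorem core_adj_unique (hh : T.IsHeightFunction h) (hH : ∀ u ∈ U, h u = H)
    (hT : T.toSimpleGraphInclusive.IsAcyclic) {r : V}
    (hr : ∀ s ∈ T.branchOut U, ReflTransGen T.Adj r s) {t a b : V} (ht : t ∈ U)
    (ha : a ∈ T.core U) (hb : b ∈ T.core U) (hat : T.Adj a t) (hbt : T.Adj b t) : a = b := by
  have key : ∀ a ∈ T.core U, T.Adj a t → (T.avoid t).Reachable r a := by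
    intro a ha hat
    have h1 := hh _ _ hat
    rcases ha with ha | ⟨-, s, hs, hsa⟩
    · exact absurd hat (not_adj_ancestor hh hH ha (subset_ancestors ht))
    · have hsH : h s < h t := by
        obtain ⟨y, hy, -, -, -, hsy, -⟩ := hs
        have h2 := hh _ _ hsy
        have h3 := height_le_of_mem_ancestors hh hH hy
        rw [hH t ht]
        omega
      refine (hh.reachable_avoid (hr s hs) (Or.inl hsH)).trans ?_
      rcases hsa with hsa | has
      · exact hh.reachable_avoid hsa (Or.inl (by omega))
      · exact (hh.reachable_avoid has (Or.inl hsH)).symm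
  exact eq_of_reachable_avoid hT (hh.inclusive_adj hat).symm (hh.inclusive_adj hbt).symm
    ((key a ha hat).symm.trans (key b hb hbt))

/-- If `x` leads to a branching ancestor by an edge other than the one to `y`, then `x` itself
branches. -/
theorem core_out_closed (hh : T.IsHeightFunction h) (hH : ∀ u ∈ U, h u = H) {x y : V}
    (hx : x ∈ T.core U) (hy : y ∈ T.ancestors U) (hxy : T.Adj x y) : y ∈ T.core U := by
  rcases hx with hx | ⟨-, s, hs, hsx | hxs⟩
  · exact absurd hxy (not_adj_ancestor hh hH hx hy)
  · exact Or.inr ⟨hy, s, hs, Or.inl (hsx.tail hxy)⟩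
  · rcases hxs.cases_head with rfl | ⟨z, hxz, hzs⟩
    · exact Or.inr ⟨hy, x, hs, Or.inl (.single hxy)⟩
    · by_cases hyz : y = z
      · subst hyz
        exact Or.inr ⟨hy, s, hs, Or.inr hzs⟩
      · obtain ⟨w, hw, -, -, -, hsw, -⟩ := hs
        obtain ⟨u, hu, hwu⟩ := hw
        exact Or.inr ⟨hy, x, ⟨y, hy, z, ⟨u, hu, hzs.trans (hwu.head hsw)⟩, hyz, hxy, hxz⟩,
          Or.inl (.single hxy)⟩

theorem core_in_closed (hU : ∀ t ∉ U, ∀ a b, T.Adj a t → T.Adj b t → a = b) {x a : V}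
    (hx : x ∈ T.core U) (hxU : x ∉ U) (hax : T.Adj a x) : a ∈ T.core U := by
  rcases hx with hx | ⟨hxP, s, hs, hsx | hxs⟩
  · exact absurd hx hxU
  · refine Or.inr ⟨mem_ancestors_of_adj hax hxP, s, hs, ?_⟩
    rcases hsx.cases_tail with rfl | ⟨b, hsb, hbx⟩
    · exact Or.inr (.single hax)
    · rw [hU x hxU a b hax hbx]
      exact Or.inl hsb
  · exact Or.inr ⟨mem_ancestors_of_adj hax hxP, s, hs, Or.inr (hxs.head hax)⟩

theorem out_unique_of_notMem_core {x y z : V} (hx : x ∈ T.ancestors U) (hxc : x ∉ T.core U)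
    (hy : y ∈ T.ancestors U) (hz : z ∈ T.ancestors U) (hxy : T.Adj x y) (hxz : T.Adj x z) :
    y = z := by
  by_contra hyz
  exact hxc (Or.inr ⟨hx, x, ⟨y, hy, z, hz, hyz, hxy, hxz⟩, Or.inl .refl⟩)

theorem adj_unique_of_notMem_branchIn [Finite V] {t : V} (ht : t ∉ T.branchIn) (a b : V)
    (ha : T.Adj a t) (hb : T.Adj b t) : a = b := by
  by_contra hab
  refine ht ?_
  change 1 < {w | T.Adj w t}.ncard
  exact (Set.one_lt_ncard (Set.toFinite _)).2 ⟨a, ha, b, hb, hab⟩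

end Core

end Digraph

/-! ### Assembling the embedding -/

theorem theorem2 {V : Type u} [Finite V] (T : Digraph V)
    (hT : T.IsOrientedTree)
    (hgrounded : T.IsGrounded)
    (S : Set V)
    (hS : T.IsMinimalSubtreeContaining T.branchIn S)
    (harb : (T.induce S).IsOutArborescence) :
    Digraph.IsEnforcible.{u, v} T := by
  obtain ⟨h, hh, hconst⟩ := hgrounded
  set U := T.branchIn with hUdef
  have hacyc := hT.isTree.isAcyclic
  have : Nonempty V := hT.isTree.connected.nonempty
  have hU : ∀ t ∉ U, ∀ a b, T.Adj a t → T.Adj b t → a = b :=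
    fun t ht => Digraph.adj_unique_of_notMem_branchIn ht
  obtain ⟨H, hH⟩ : ∃ H, ∀ u ∈ U, h u = H := by
    rcases U.eq_empty_or_nonempty with he | ⟨u, hu⟩
    · exact ⟨0, by simp [he]⟩
    · exact ⟨h u, fun w hw => hconst w hw u hu⟩
  obtain ⟨r, hr⟩ := harb.exists_root
  have hr' : ∀ s ∈ T.branchOut U, Relation.ReflTransGen T.Adj r.1 s := fun s hs =>
    Digraph.reflTransGen_of_induce (hr ⟨s, Digraph.branchOut_subset hh hacyc
      harb.1.isTree.connected hS.prop.1 hs⟩)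
  set n := Nat.card V with hn
  have hn1 : 1 ≤ n := Nat.card_pos
  obtain ⟨k, hk⟩ : ∃ k : ℕ, ∀ t, (H - h t).toNat < k := by
    obtain ⟨M, hM⟩ := (Set.finite_range fun t => (H - h t).toNat).bddAbove
    exact ⟨M + 1, fun t => Nat.lt_succ_of_le (hM ⟨t, rfl⟩)⟩
  obtain ⟨d, hd⟩ := Digraph.exists_bound_outLevel.{v} n n n k hn1
  refine ⟨max d n, fun W _ _ G _ hG => ?_⟩
  have hdeg : ∀ w, max d n ≤ {x | G.Adj w x}.ncard := fun w =>
    hG.trans (ciInf_le (OrderBot.bddBelow _) w)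
  -- Depth below `H` is the level, so `U` lands on level 0, the robust vertices.
  let C : V → Set W := fun t => G.outLevel n {v | G.IsRobust n n v} (H - h t).toNat
  obtain ⟨f, hf, hfC⟩ := Digraph.EmbedsOn.exists_extension (G := G) hh C (T.core U)
    (fun t _ => hd W G (fun w => (le_max_left _ _).trans (hdeg w)) _ (hk t))
    (fun a ha t ht hat w hw => by
      have h1 := hh _ _ hat
      have h2 := Digraph.height_le_of_mem_ancestors hh hH (Digraph.core_subset ht)
      have h3 : (H - h a).toNat = (H - h t).toNat + 1 := by omega
      simp only [C, h3] at hw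
      exact hw)
    ∅ (fun _ => Classical.arbitrary W) (Set.empty_subset _) ⟨by simp, by simp⟩ (by simp) (by simp)
    (fun t _ _ a ha b hb hat hbt => by
      by_cases htU : t ∈ U
      · exact Digraph.core_adj_unique hh hH hacyc hr' htU ha hb hat hbt
      · exact hU t htU a b hat hbt)
  obtain ⟨D, g, hg, hUD, hD⟩ := Digraph.EmbedsOn.exists_extension_inPaths hh
    (fun t ht a hat => Digraph.mem_ancestors_of_adj hat ht) hU (T.core U) f hf
    Digraph.core_subset Set.subset_union_left
    (fun x hx y hy hxy => Digraph.core_out_closed hh hH hx hy hxy)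
    (fun x hx hxc y hy z hz => Digraph.out_unique_of_notMem_core hx hxc hy hz)
    (fun x hx hxU a hax => Digraph.core_in_closed hU hx hxU hax)
    (fun u hu => by
      have := hfC u (Or.inl hu)
      simp only [C, hH u hu, sub_self, Int.toNat_zero] at this
      exact this)
  have hout : ∀ w, n ≤ {x | G.Adj w x}.ncard := fun w => (le_max_right _ _).trans (hdeg w)
  -- `D` is closed under in-neighbours and contains `U`, so the rest is greedy with no restriction
  -- on targets; this uses out-degree at least `n`.
  obtain ⟨F, hF, -⟩ := Digraph.EmbedsOn.exists_extension hh (fun _ => (Set.univ : Set W)) Set.univ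
    (fun _ _ => (hout (Classical.arbitrary W)).trans (Set.ncard_le_ncard (Set.subset_univ _)))
    (fun a _ t _ _ w _ => by simpa using hout w) D g (Set.subset_univ _) hg (by simp)
    (fun t ht a _ hat => hD t ht a hat) (fun t _ htD a _ b _ => hU t (fun h => htD (hUD h)) a b)
  exact ⟨F, fun a b hab => hF.injOn (Set.mem_univ a) (Set.mem_univ b) hab,
    fun a b => hF.adj a (Set.mem_univ a) b (Set.mem_univ b)⟩
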